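/- For an integer $m\ge 1$, a vector $\Theta=(\theta^1,\dots,\theta^m)\in\mathbb R^m$ and an integer vector ${\bf x}=(x_1,\dots,x_m)\in\mathbb Z^m$ put $$M({\bf x})=\max_{1\le i\le m}|x_i|,\qquad \zeta({\bf x})=\|\theta^1x_1+\dots+\theta^mx_m\|,$$ where $\|\cdot\|$ is the distance to the nearest integer. A nonzero ${\bf x}\in\mathbb Z^m$ is called a best approximation for $\Theta$ if $\zeta({\bf x})=\min\zeta({\bf x}')$, the minimum being over all ${\bf x}'\in\mathbb Z^m$ with $0<M({\bf x}')\le M({\bf x})$. Let $\dim_{\mathbb Z}\Theta$ be the maximal number of elements of the list $1,\theta^1,\dots,\theta^m$ that are linearly independent over $\mathbb Z$. If $\dim_{\mathbb Z}\Theta=m+1$, then the best approximations for $\Theta$ form an infinite sequence $\pm{\bf x}_1,\pm{\bf x}_2,\dots$, unique up to the signs, with $M({\bf x}_1)<M({\bf x}_2)<\cdots$ and $\zeta({\bf x}_1)>\zeta({\bf x}_2)>\cdots$; write $M_\nu=M({\bf x}_\nu)$ and $\zeta_\nu=\zeta({\bf x}_\nu)$. **Theorem.** Let $m\ge 3$.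 Let $\psi:[1,\infty)\to(0,\infty)$ be any non-increasing function with $\psi(t)\to 0$ as $t\to+\infty$ (it may decrease arbitrarily fast), and let $\tau(1),\tau(2),\tau(3),\dots$ be any sequence of positive integers with $\tau(\nu)\to\infty$ as $\nu\to\infty$ (it may grow arbitrarily fast). Then there exists $\Theta\in\mathbb R^m$ with $\dim_{\mathbb Z}\Theta=m+1$ such that $$\zeta_\nu\le\psi\bigl(M_{\nu+\tau(\nu)}\bigr)\qquad\text{for all }\nu\ge 1.$$ -/

import Mathlib

open Filter Topology

namespace BestApprox

/-- The linear form `L_Θ(x) = θ¹ x₁ + ⋯ + θᵐ x_m` at an integer vector. -/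
noncomputable def linForm {m : ℕ} (Θ : Fin m → ℝ) (x : Fin m → ℤ) : ℝ :=
  ∑ i, Θ i * (x i : ℝ)

/-- The distance from a real number to the nearest integer. -/
noncomputable def distInt (r : ℝ) : ℝ := |r - (round r : ℝ)|

/-- `M(x) = max_i |x_i|`, a natural number. -/
def height {m : ℕ} (x : Fin m → ℤ) : ℕ :=
  Finset.univ.sup fun i => (x i).natAbs

/-- `ζ(x) = ‖L_Θ(x)‖`, where `‖·‖` is the distance to the nearest integer. -/
noncomputable def zeta {m : ℕ} (Θ : Fin m → ℝ) (x : Fin m → ℤ) : ℝ :=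
  distInt (linForm Θ x)

/-- `x` is a best approximation for `Θ`: it is nonzero, and `ζ(x)` is the minimum of `ζ(x')` over
all integer vectors `x'` with `0 < M(x') ≤ M(x)`. -/
def IsBestApprox {m : ℕ} (Θ : Fin m → ℝ) (x : Fin m → ℤ) : Prop :=
  0 < height x ∧
    ∀ x' : Fin m → ℤ, 0 < height x' → height x' ≤ height x → zeta Θ x ≤ zeta Θ x'

/-- `x₁, x₂, …` is the infinite sequence of best approximations for `Θ`: the best approximations
are exactly the vectors `±x_ν`, `M(x_ν)` is strictly increasing, and `ζ(x_ν)` is strictly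
decreasing. -/
structure IsBestApproxSeq {m : ℕ} (Θ : Fin m → ℝ) (x : ℕ+ → Fin m → ℤ) : Prop where
  isBestApprox_iff : ∀ v : Fin m → ℤ, IsBestApprox Θ v ↔ ∃ ν : ℕ+, v = x ν ∨ v = -x ν
  height_strictMono : StrictMono fun ν => height (x ν)
  zeta_strictAnti : StrictAnti fun ν => zeta Θ (x ν)

/-- `dim_ℤ Θ`: the maximal number of members of the list `1, θ¹, …, θᵐ` that are linearly
independent over `ℤ`. -/
noncomputable def dimZ {m : ℕ} (Θ : Fin m → ℝ) : ℕ :=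
  sSup {k : ℕ | ∃ s : Finset (Fin (m + 1)), s.card = k ∧
    LinearIndepOn ℤ (Fin.cons 1 Θ : Fin (m + 1) → ℝ) (s : Set (Fin (m + 1)))}

end BestApprox

/-!
Write `L_Θ` for the linear form with coefficients `Θ` and `Λ(B) = {x : L_B(x) ∈ ℤ}` for the lattice
of relations of `B`. If `δ > 0` is small, then `ζ_{B + δη}(x) = δ |L_η(x)|` for the `x ∈ Λ(B)` of
bounded height, while the other vectors of bounded height stay far from zero. So the best
approximations of `B + δη` within a bounded range are governed by `|L_η|` on `Λ(B)`, independently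
of `δ`, and their values of `ζ` are as small as desired.

The vector `Θ` is a limit of rational vectors `B_{k+1} = B_k + δ_k η_k` with integer directions
`η_k`. On a bounded range `Λ(B_{k+1})` is `Λ_k = Λ(B_k) ∩ ker L_{η_k}`
(`eventually_mem_relations_iff`), and `Λ_k` is known before `δ_k` is. The lattice `Λ_k` has rank at
least two, so the minima of `|L_ξ|` on it over growing ranges drop arbitrarily often when `ξ` is
generic (`exists_chain_generic`), and an integer direction `η_{k+1}` close to that of `ξ` keeps as
many drops as desired; let `H_{k+1}` bound the range in which they occur. As `m ≥ 3`, the lattice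
`Λ_k ∩ ker L_{η_{k+1}}` contains a nonzero vector `v`, of height at most `H_{k+1}` say. It belongs
to `Λ(B_{k+1})` and to `Λ(B_{k+2})`, hence survives two steps, and `ζ(v)` becomes proportional to
`δ_{k+2}`, which is chosen after `H_{k+3}`. This overlap yields `ζ_ν ≤ ψ(H_{k+3})` as soon as
`M_ν ≥ H_{k+1}`, whereas the range from `H_{k+2}` to `H_{k+3}` contains enough best approximations
to ensure `M_{ν+τ(ν)} ≤ H_{k+3}` whenever `M_ν ≤ H_{k+2}`.

All requirements are open conditions on `Θ`, so they hold at a point of a nested sequence of closed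
balls. That the minimum of `ζ_Θ` drops infinitely often also shows `ζ_Θ(x) ≠ 0` for `x ≠ 0`, that is
`dim_ℤ Θ = m + 1`.
-/

namespace BestApprox

/-! ### The linear form, the height and the distance to the nearest integer -/

section Basic

variable {m : ℕ}

lemma linForm_add_smul (B η : Fin m → ℝ) (δ : ℝ) (x : Fin m → ℤ) :
    linForm (B + δ • η) x = linForm B x + δ * linForm η x := by
  simp only [linForm, Pi.add_apply, Pi.smul_apply, smul_eq_mul, Finset.mul_sum,
    ← Finset.sum_add_distrib]
  exact Finset.sum_congr rfl fun i _ => by ring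

lemma linForm_sub (Θ : Fin m → ℝ) (x y : Fin m → ℤ) :
    linForm Θ (x - y) = linForm Θ x - linForm Θ y := by
  simp [linForm, mul_sub]

lemma linForm_add (Θ : Fin m → ℝ) (x y : Fin m → ℤ) :
    linForm Θ (x + y) = linForm Θ x + linForm Θ y := by
  simp [linForm, mul_add, Finset.sum_add_distrib]

lemma linForm_zsmul (Θ : Fin m → ℝ) (k : ℤ) (x : Fin m → ℤ) :
    linForm Θ (k • x) = k * linForm Θ x := by
  simp only [linForm, Pi.smul_apply, smul_eq_mul, Int.cast_mul, Finset.mul_sum]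
  exact Finset.sum_congr rfl fun i _ => by ring

lemma linForm_neg (Θ : Fin m → ℝ) (x : Fin m → ℤ) : linForm Θ (-x) = -linForm Θ x := by
  simp [linForm]

lemma continuous_linForm (x : Fin m → ℤ) : Continuous fun Θ : Fin m → ℝ => linForm Θ x := by
  unfold linForm
  fun_prop

lemma natAbs_le_height (x : Fin m → ℤ) (i : Fin m) : (x i).natAbs ≤ height x :=
  Finset.le_sup (f := fun i => (x i).natAbs) (Finset.mem_univ i)

lemma height_pos_iff {x : Fin m → ℤ} : 0 < height x ↔ x ≠ 0 := by
  rw [ne_eq, ← not_iff_not, not_lt, not_not, Nat.le_zero]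
  refine ⟨fun h => funext fun i => ?_, fun h => ?_⟩
  · have := natAbs_le_height x i
    simp only [Pi.zero_apply]
    omega
  · subst h
    simp [height]

lemma height_neg (x : Fin m → ℤ) : height (-x) = height x := by
  simp [height]

lemma finite_height_le (H : ℕ) : {x : Fin m → ℤ | height x ≤ H}.Finite := by
  refine (Set.finite_Icc (fun _ : Fin m => -(H : ℤ)) fun _ => (H : ℤ)).subset fun x hx => ?_
  simp only [Set.mem_ofPred_eq] at hx
  refine ⟨fun i => ?_, fun i => ?_⟩ <;>
  · have := natAbs_le_height x i
    dsimp only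
    omega

lemma distInt_eq_norm (r : ℝ) : distInt r = ‖(r : UnitAddCircle)‖ :=
  UnitAddCircle.norm_eq.symm

lemma continuous_distInt : Continuous distInt := by
  have : distInt = fun r : ℝ => ‖(r : UnitAddCircle)‖ := funext distInt_eq_norm
  rw [this]
  exact continuous_norm.comp (AddCircle.continuous_mk' 1)

lemma distInt_nonneg (r : ℝ) : 0 ≤ distInt r := abs_nonneg _

lemma distInt_int_add (n : ℤ) (r : ℝ) : distInt (n + r) = distInt r := by
  simp [distInt, round_intCast_add]

lemma distInt_of_abs_le_half {r : ℝ} (hr : |r| ≤ 1 / 2) : distInt r = |r| := by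
  rw [distInt_eq_norm, AddCircle.norm_coe_eq_abs_iff 1 one_ne_zero]
  simpa using hr

lemma distInt_eq_zero_iff {r : ℝ} : distInt r = 0 ↔ ∃ n : ℤ, r = n := by
  refine ⟨fun h => ⟨round r, sub_eq_zero.1 (abs_eq_zero.1 h)⟩, ?_⟩
  rintro ⟨n, rfl⟩
  simp [distInt]

lemma exists_sub_or_add_eq_of_distInt_eq {r s : ℝ} (h : distInt r = distInt s) :
    (∃ n : ℤ, r - s = n) ∨ ∃ n : ℤ, r + s = n := by
  rcases abs_eq_abs.1 h with h | h
  · exact .inl ⟨round r - round s, by push_cast; linarith⟩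
  · exact .inr ⟨round r + round s, by push_cast; linarith⟩

lemma zeta_nonneg (Θ : Fin m → ℝ) (x : Fin m → ℤ) : 0 ≤ zeta Θ x := distInt_nonneg _

lemma continuous_zeta (x : Fin m → ℤ) : Continuous fun Θ : Fin m → ℝ => zeta Θ x :=
  continuous_distInt.comp (continuous_linForm x)

lemma zeta_neg (Θ : Fin m → ℝ) (x : Fin m → ℤ) : zeta Θ (-x) = zeta Θ x := by
  rw [zeta, zeta, linForm_neg, distInt_eq_norm, distInt_eq_norm, AddCircle.coe_neg, norm_neg]

/-- The integer vectors at which the linear form of `Θ` takes an integer value. -/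
def relations (Θ : Fin m → ℝ) : Set (Fin m → ℤ) := {x | ∃ n : ℤ, linForm Θ x = n}

lemma zeta_eq_zero_iff {Θ : Fin m → ℝ} {x : Fin m → ℤ} : zeta Θ x = 0 ↔ x ∈ relations Θ :=
  distInt_eq_zero_iff

lemma eq_or_eq_neg_of_zeta_eq {Θ : Fin m → ℝ} (hΘ : ∀ x ∈ relations Θ, x = 0)
    {x y : Fin m → ℤ} (h : zeta Θ x = zeta Θ y) : x = y ∨ x = -y := by
  rcases exists_sub_or_add_eq_of_distInt_eq h with ⟨n, hn⟩ | ⟨n, hn⟩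
  · exact .inl (sub_eq_zero.1 (hΘ _ ⟨n, by rw [linForm_sub, hn]⟩))
  · exact .inr (eq_neg_of_add_eq_zero_left (hΘ _ ⟨n, by rw [linForm_add, hn]⟩))

/-- Without integer relations, the dimension over `ℤ` is the full one. -/
lemma dimZ_eq_of_relations {Θ : Fin m → ℝ} (hΘ : ∀ x ∈ relations Θ, x = 0) :
    dimZ Θ = m + 1 := by
  refine IsGreatest.csSup_eq ⟨⟨Finset.univ, by simp, ?_⟩, ?_⟩
  · rw [Finset.coe_univ, linearIndepOn_univ_iff, Fintype.linearIndependent_iff]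
    intro g hg
    rw [Fin.sum_univ_succ] at hg
    simp only [Fin.cons_zero, Fin.cons_succ, zsmul_eq_mul, mul_one] at hg
    have h0 : (fun i : Fin m => g i.succ) = 0 := by
      refine hΘ _ ⟨-g 0, ?_⟩
      simp only [linForm, Int.cast_neg]
      simp_rw [mul_comm (Θ _)]
      linarith
    have h1 : ∀ i : Fin m, g i.succ = 0 := fun i => congrFun h0 i
    refine Fin.cases ?_ h1
    simpa [h1] using hg
  · rintro k ⟨s, rfl, -⟩
    simpa using Finset.card_le_univ s

end Basic

/-! ### Successive drops of the minimum -/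

section Chain

variable {m : ℕ}

/-- Some nonzero vector of `S` of height at most `b` has a smaller value of `f` than all nonzero
vectors of `S` of height at most `a`. -/
def Improves (f : (Fin m → ℤ) → ℝ) (S : Set (Fin m → ℤ)) (a b : ℕ) : Prop :=
  ∃ y ∈ S, 0 < height y ∧ height y ≤ b ∧
    ∀ x ∈ S, 0 < height x → height x ≤ a → f y < f x

/-- Between the heights `a` and `b` the minimum of `f` over `S` drops at least `n` times. -/
def Chain (f : (Fin m → ℤ) → ℝ) (S : Set (Fin m → ℤ)) : ℕ → ℕ → ℕ → Prop
  | 0, a, b => a ≤ b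
  | n + 1, a, b => ∃ c, Chain f S n a c ∧ Improves f S c b

variable {f g : (Fin m → ℤ) → ℝ} {S R : Set (Fin m → ℤ)} {a b b' n : ℕ}

lemma Improves.lt (h : Improves f S a b) : a < b := by
  obtain ⟨y, hy, h0, hb, hlt⟩ := h
  by_contra! hba
  exact lt_irrefl _ (hlt y hy h0 (hb.trans hba))

lemma Improves.mono_right (h : Improves f S a b) (hb : b ≤ b') : Improves f S a b' := by
  obtain ⟨y, hy, h0, hyb, hlt⟩ := h
  exact ⟨y, hy, h0, hyb.trans hb, hlt⟩

lemma Chain.mono_right (h : Chain f S n a b) (hb : b ≤ b') : Chain f S n a b' := by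
  cases n with
  | zero => exact le_trans (show a ≤ b from h) hb
  | succ n =>
    obtain ⟨c, hc, hcb⟩ := h
    exact ⟨c, hc, hcb.mono_right hb⟩

lemma Chain.le (h : Chain f S n a b) : a ≤ b := by
  induction n generalizing b with
  | zero => exact h
  | succ n ih =>
    obtain ⟨c, hc, hcb⟩ := h
    exact (ih hc).trans hcb.lt.le

lemma Chain.lt (h : Chain f S n a b) (hn : 0 < n) : a < b := by
  cases n with
  | zero => exact absurd hn (lt_irrefl 0)
  | succ n =>
    obtain ⟨c, hc, hcb⟩ := h
    exact hc.le.trans_lt hcb.lt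

lemma Chain.exists_improves (h : Chain f S n a b) (hn : 0 < n) : ∃ c, a ≤ c ∧ Improves f S c b := by
  cases n with
  | zero => exact absurd hn (lt_irrefl 0)
  | succ n =>
    obtain ⟨c, hc, hcb⟩ := h
    exact ⟨c, hc.le, hcb⟩

/-- Only the order of the values of `f` on the vectors of `S` of height at most `b` matters. -/
lemma Chain.congr (h : Chain f S n a b) (hSR : ∀ x, height x ≤ b → (x ∈ R ↔ x ∈ S))
    (hfg : ∀ x y, f y < f x → g y < g x) : Chain g R n a b := by
  induction n generalizing b with
  | zero => exact h
  | succ n ih =>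
    obtain ⟨c, hc, hcb⟩ := h
    have hlt := hcb.lt
    obtain ⟨y, hy, h0, hyb, hmin⟩ := hcb
    exact ⟨c, ih hc fun x hx => hSR x (hx.trans hlt.le), y, (hSR y hyb).2 hy, h0, hyb,
      fun x hx hx0 hxc => hfg _ _ (hmin x ((hSR x (hxc.trans hlt.le)).1 hx) hx0 hxc)⟩

/-- Drops of the minimum persist under pointwise limits, as they involve finitely many vectors
and strict inequalities. -/
lemma Chain.eventually {ι : Type*} {l : Filter ι} {F : ι → (Fin m → ℤ) → ℝ}
    (h : Chain f S n a b) (hF : ∀ x, Tendsto (fun i => F i x) l (𝓝 (f x))) :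
    ∀ᶠ i in l, Chain (F i) S n a b := by
  induction n generalizing b with
  | zero => exact .of_forall fun _ => h
  | succ n ih =>
    obtain ⟨c, hc, y, hy, h0, hyb, hmin⟩ := h
    have hev : ∀ᶠ i in l, ∀ x ∈ {x : Fin m → ℤ | height x ≤ c},
        x ∈ S → 0 < height x → F i y < F i x := by
      rw [eventually_all_finite (finite_height_le c)]
      intro x hx
      by_cases hxS : x ∈ S ∧ 0 < height x
      · filter_upwards [(hF y).eventually_lt (hF x) (hmin x hxS.1 hxS.2 hx)] with i hi _ _ using hi
      · exact .of_forall fun i h1 h2 => absurd ⟨h1, h2⟩ hxS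
    filter_upwards [ih hc, hev] with i h1 h2
    exact ⟨c, h1, y, hy, h0, hyb, fun x hx hx0 hxc => h2 x hxc hx hx0⟩

end Chain

/-! ### Small perturbations -/

section Perturbation

variable {m : ℕ}

lemma eventually_zeta_perturb_eq {B : Fin m → ℝ} (η : Fin m → ℝ) {x : Fin m → ℤ}
    (hx : x ∈ relations B) :
    ∀ᶠ δ in 𝓝[>] (0 : ℝ), zeta (B + δ • η) x = δ * |linForm η x| := by
  obtain ⟨n, hn⟩ := hx
  have hlim : Tendsto (fun δ : ℝ => |δ * linForm η x|) (𝓝[>] 0) (𝓝 0) := by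
    have : Continuous fun δ : ℝ => |δ * linForm η x| := by fun_prop
    simpa using (this.tendsto 0).mono_left nhdsWithin_le_nhds
  filter_upwards [hlim.eventually_le_const (show (0 : ℝ) < 1 / 2 by norm_num),
    self_mem_nhdsWithin] with δ hδ hpos
  rw [zeta, linForm_add_smul, hn, distInt_int_add, distInt_of_abs_le_half hδ, abs_mul,
    abs_of_pos hpos]

lemma tendsto_perturb (B η : Fin m → ℝ) :
    Tendsto (fun δ : ℝ => B + δ • η) (𝓝[>] 0) (𝓝 B) := by
  have : Continuous fun δ : ℝ => B + δ • η := by fun_prop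
  simpa using (this.tendsto 0).mono_left nhdsWithin_le_nhds

lemma tendsto_zeta_perturb (B η : Fin m → ℝ) (x : Fin m → ℤ) :
    Tendsto (fun δ : ℝ => zeta (B + δ • η) x) (𝓝[>] 0) (𝓝 (zeta B x)) :=
  ((continuous_zeta x).tendsto B).comp (tendsto_perturb B η)

/-- Up to a given height, the relations that survive a small perturbation are those in the
kernel of its direction. -/
lemma eventually_mem_relations_iff (B η : Fin m → ℝ) (H : ℕ) :
    ∀ᶠ δ in 𝓝[>] (0 : ℝ), ∀ x : Fin m → ℤ, height x ≤ H →
      (x ∈ relations (B + δ • η) ↔ x ∈ relations B ∧ linForm η x = 0) := by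
  suffices h : ∀ᶠ δ in 𝓝[>] (0 : ℝ), ∀ x ∈ {x : Fin m → ℤ | height x ≤ H},
      (x ∈ relations (B + δ • η) ↔ x ∈ relations B ∧ linForm η x = 0) from h
  rw [eventually_all_finite (finite_height_le H)]
  intro x _
  by_cases hx : x ∈ relations B
  · filter_upwards [eventually_zeta_perturb_eq η hx, self_mem_nhdsWithin] with δ hδ hpos
    rw [← zeta_eq_zero_iff, hδ]
    have : δ ≠ 0 := ne_of_gt hpos
    simp [hx, this]
  · have hpos : 0 < zeta B x :=
      lt_of_le_of_ne (zeta_nonneg _ _) fun h => hx (zeta_eq_zero_iff.1 h.symm)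
    filter_upwards [(tendsto_zeta_perturb B η x).eventually_const_lt hpos] with δ hδ
    rw [← zeta_eq_zero_iff]
    simp [hx, hδ.ne']

/-- Drops of `|L_η|` on the relations of `B` become drops of `ζ` at `B + δη`. -/
lemma Chain.eventually_perturb {B η : Fin m → ℝ} {n a b : ℕ}
    (h : Chain (fun x => |linForm η x|) (relations B) n a b) :
    ∀ᶠ δ in 𝓝[>] (0 : ℝ), Chain (zeta (B + δ • η)) Set.univ n a b := by
  induction n generalizing b with
  | zero => exact .of_forall fun _ => h
  | succ n ih =>
    obtain ⟨c, hc, y, hy, h0, hyb, hmin⟩ := h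
    have hev : ∀ᶠ δ in 𝓝[>] (0 : ℝ), ∀ x ∈ {x : Fin m → ℤ | height x ≤ c},
        0 < height x → zeta (B + δ • η) y < zeta (B + δ • η) x := by
      rw [eventually_all_finite (finite_height_le c)]
      intro x hxc
      by_cases hx0 : 0 < height x
      swap
      · exact .of_forall fun δ h => absurd h hx0
      by_cases hx : x ∈ relations B
      · filter_upwards [eventually_zeta_perturb_eq η hx, eventually_zeta_perturb_eq η hy,
          self_mem_nhdsWithin] with δ h1 h2 hpos _
        rw [h1, h2]
        exact mul_lt_mul_of_pos_left (hmin x hx hx0 hxc) hpos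
      · have hlt : zeta B y < zeta B x := by
          rw [zeta_eq_zero_iff.2 hy]
          exact lt_of_le_of_ne (zeta_nonneg _ _) fun h => hx (zeta_eq_zero_iff.1 h.symm)
        filter_upwards [(tendsto_zeta_perturb B η y).eventually_lt
          (tendsto_zeta_perturb B η x) hlt] with δ hδ _ using hδ
    filter_upwards [ih hc, hev] with δ h1 h2
    exact ⟨c, h1, y, trivial, h0, hyb, fun x _ hx0 hxc => h2 x hxc hx0⟩

end Perturbation

/-! ### Lattices of relations and generic directions -/

section Lattice

variable {m : ℕ}

/-- All coordinates of `B` are rational, expressed by a common denominator. -/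
def IsRationalVec (B : Fin m → ℝ) : Prop :=
  ∃ d : ℤ, d ≠ 0 ∧ ∀ i, ∃ n : ℤ, d * B i = n

/-- The linear form with integer coefficients `η`, as a linear map over `ℤ`. -/
def intForm (η : Fin m → ℤ) : (Fin m → ℤ) →ₗ[ℤ] ℤ :=
  ∑ i, η i • LinearMap.proj i

lemma intForm_apply (η x : Fin m → ℤ) : intForm η x = ∑ i, η i * x i := by
  simp [intForm]

lemma linForm_intCast (η x : Fin m → ℤ) :
    linForm (fun i => (η i : ℝ)) x = (intForm η x : ℤ) := by
  simp [linForm, intForm_apply]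

/-- For `m ≥ 3`, a rational vector has a nonzero relation in the kernel of any two integral
linear forms. -/
lemma exists_relation_ker_ker (hm : 3 ≤ m) {B : Fin m → ℝ} (hB : IsRationalVec B)
    (η η' : Fin m → ℤ) :
    ∃ x ∈ relations B, x ≠ 0 ∧ intForm η x = 0 ∧ intForm η' x = 0 := by
  have hinj : ¬ Function.Injective (LinearMap.pi ![intForm η, intForm η']) := fun h => by
    have := le_of_fin_injective ℤ _ h
    omega
  rw [← LinearMap.ker_eq_bot, ← ne_eq, Submodule.ne_bot_iff] at hinj
  obtain ⟨x, hx, hx0⟩ := hinj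
  rw [LinearMap.mem_ker] at hx
  have h0 : intForm η x = 0 := congrFun hx 0
  have h1 : intForm η' x = 0 := congrFun hx 1
  obtain ⟨d, hd, hdB⟩ := hB
  choose c hc using hdB
  refine ⟨d • x, ⟨intForm c x, ?_⟩, smul_ne_zero hd hx0, by rw [map_smul, h0, smul_zero],
    by rw [map_smul, h1, smul_zero]⟩
  rw [linForm_zsmul, ← linForm_intCast, linForm, linForm, Finset.mul_sum]
  exact Finset.sum_congr rfl fun i _ => by rw [← hc]; ring

/-- There is a direction with nonnegative coordinates whose linear form vanishes at no nonzero
integer vector: the powers of a transcendental number. -/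
lemma exists_generic (m : ℕ) :
    ∃ ξ : Fin m → ℝ, (∀ i, 0 ≤ ξ i) ∧ ∀ x : Fin m → ℤ, x ≠ 0 → linForm ξ x ≠ 0 := by
  have ht : Transcendental ℤ (liouvilleNumber (2 : ℕ)) := transcendental_liouvilleNumber le_rfl
  set t : ℝ := liouvilleNumber (2 : ℕ) with htdef
  have ht0 : 0 ≤ t := by
    rw [htdef, liouvilleNumber]
    positivity
  refine ⟨fun i => t ^ (i : ℕ), fun i => by positivity, fun x hx h => hx ?_⟩
  let p : Polynomial ℤ := ∑ i : Fin m, Polynomial.monomial (i : ℕ) (x i)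
  have hp : Polynomial.aeval t p = 0 := by
    rw [← h, linForm, map_sum]
    exact Finset.sum_congr rfl fun i _ => by simp [Polynomial.aeval_monomial, mul_comm]
  have hp0 : p = 0 := transcendental_iff.1 ht p hp
  funext i
  have := congrArg (fun q => Polynomial.coeff q (i : ℕ)) hp0
  simpa [p, Polynomial.finsetSum_coeff, Polynomial.coeff_monomial, Fin.val_inj] using this

/-- On the lattice of relations of a rational vector in the kernel of an integral form, a generic
form takes arbitrarily small values: the lattice has rank at least two. -/
lemma exists_abs_linForm_lt (hm : 3 ≤ m) {B : Fin m → ℝ} (hB : IsRationalVec B)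
    (η : Fin m → ℤ) {ξ : Fin m → ℝ} (hξ : ∀ x : Fin m → ℤ, x ≠ 0 → linForm ξ x ≠ 0)
    {ε : ℝ} (hε : 0 < ε) :
    ∃ y, (y ∈ relations B ∧ intForm η y = 0) ∧ y ≠ 0 ∧ |linForm ξ y| < ε := by
  obtain ⟨p, ⟨np, hnp⟩, hp0, hpη, -⟩ := exists_relation_ker_ker hm hB η η
  -- A second relation `q`, orthogonal to `p`, is linearly independent of `p`.
  obtain ⟨q, ⟨nq, hnq⟩, hq0, hqη, hqp⟩ := exists_relation_ker_ker hm hB η p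
  have hβ : 0 < |linForm ξ q| := abs_pos.2 (hξ q hq0)
  obtain ⟨N, hN⟩ := exists_nat_gt (|linForm ξ q| / ε)
  have hN0 : 0 < N := by
    have : (0 : ℝ) < N := (by positivity : (0 : ℝ) ≤ |linForm ξ q| / ε).trans_lt hN
    exact_mod_cast this
  obtain ⟨j, k, hk, -, hjk⟩ :=
    Real.exists_int_int_abs_mul_sub_le (linForm ξ p / linForm ξ q) hN0
  refine ⟨k • p - j • q, ⟨⟨k * np - j * nq, ?_⟩, ?_⟩, fun h => ?_, ?_⟩
  · rw [linForm_sub, linForm_zsmul, linForm_zsmul, hnp, hnq]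
    push_cast
    ring
  · rw [map_sub, map_smul, map_smul, hpη, hqη, smul_zero, smul_zero, sub_zero]
  · have h1 : intForm p (k • p - j • q) = 0 := by rw [h, map_zero]
    rw [map_sub, map_smul, map_smul, hqp, smul_zero, sub_zero, smul_eq_mul] at h1
    rcases mul_eq_zero.1 h1 with h1 | h1
    · exact hk.ne' h1
    · rw [intForm_apply, Finset.sum_eq_zero_iff_of_nonneg fun i _ => mul_self_nonneg _] at h1
      exact hp0 (funext fun i => mul_self_eq_zero.1 (h1 i (Finset.mem_univ i)))
  · have hq : linForm ξ q ≠ 0 := hξ q hq0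
    have heq : linForm ξ (k • p - j • q) =
        (k * (linForm ξ p / linForm ξ q) - j) * linForm ξ q := by
      rw [linForm_sub, linForm_zsmul, linForm_zsmul]
      field_simp
    rw [heq, abs_mul]
    calc _ ≤ 1 / ((N : ℝ) + 1) * |linForm ξ q| := by gcongr
      _ < ε := by
        rw [one_div_mul_eq_div, div_lt_iff₀ (by positivity)]
        rw [div_lt_iff₀ hε] at hN
        nlinarith

lemma exists_chain_generic (hm : 3 ≤ m) {B : Fin m → ℝ} (hB : IsRationalVec B)
    (η : Fin m → ℤ) {ξ : Fin m → ℝ} (hξ : ∀ x : Fin m → ℤ, x ≠ 0 → linForm ξ x ≠ 0)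
    (n a : ℕ) :
    ∃ b, Chain (fun x => |linForm ξ x|) {x | x ∈ relations B ∧ intForm η x = 0} n a b := by
  induction n with
  | zero => exact ⟨a, le_refl a⟩
  | succ n ih =>
    obtain ⟨c, hc⟩ := ih
    have hfin : {x : Fin m → ℤ | height x ≤ c ∧ x ≠ 0}.Finite :=
      (finite_height_le c).subset fun x hx => hx.1
    have hε : ∃ ε > 0, ∀ x ∈ {x : Fin m → ℤ | height x ≤ c ∧ x ≠ 0}, ε < |linForm ξ x| := by
      have : ∀ᶠ ε in 𝓝[>] (0 : ℝ), ∀ x ∈ {x : Fin m → ℤ | height x ≤ c ∧ x ≠ 0},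
          ε < |linForm ξ x| := by
        rw [eventually_all_finite hfin]
        intro x hx
        exact nhdsWithin_le_nhds (eventually_lt_nhds (abs_pos.2 (hξ x hx.2)))
      obtain ⟨ε, h1, h2⟩ := (this.and self_mem_nhdsWithin).exists
      exact ⟨ε, h2, h1⟩
    obtain ⟨ε, hε, hmin⟩ := hε
    obtain ⟨y, hy, hy0, hlt⟩ := exists_abs_linForm_lt hm hB η hξ hε
    exact ⟨height y, c, hc, y, hy, height_pos_iff.2 hy0, le_rfl, fun x _ hx0 hxc =>
      hlt.trans (hmin x ⟨hxc, height_pos_iff.1 hx0⟩)⟩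

/-- An integral direction whose form has many drops on a given lattice of relations and whose
kernel still meets this lattice. -/
lemma exists_intDirection (hm : 3 ≤ m) {B : Fin m → ℝ} (hB : IsRationalVec B)
    (η : Fin m → ℤ) (n a : ℕ) :
    ∃ (η' : Fin m → ℤ) (b : ℕ),
      Chain (fun x => |linForm (fun i => (η' i : ℝ)) x|)
        {x | x ∈ relations B ∧ intForm η x = 0} n a b ∧
      ∃ v ∈ relations B, intForm η v = 0 ∧ intForm η' v = 0 ∧ 0 < height v ∧ height v ≤ b := by
  obtain ⟨ξ, hξ0, hξ⟩ := exists_generic m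
  obtain ⟨b, hb⟩ := exists_chain_generic hm hB η hξ n a
  -- The integer vectors `⌊K ξ⌋` approximate the direction of `ξ`.
  have hlim : ∀ x : Fin m → ℤ, Tendsto
      (fun K : ℝ => |linForm (fun i => (⌊ξ i * K⌋₊ : ℝ) / K) x|) atTop (𝓝 |linForm ξ x|) := by
    intro x
    refine (((continuous_linForm x).tendsto ξ).comp (tendsto_pi_nhds.2 fun i => ?_)).abs
    exact tendsto_nat_floor_mul_div_atTop (hξ0 i)
  obtain ⟨K, hK, hK0⟩ := ((hb.eventually hlim).and (eventually_gt_atTop 0)).exists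
  let η' : Fin m → ℤ := fun i => (⌊ξ i * K⌋₊ : ℤ)
  have hscale : ∀ x, |linForm (fun i => (⌊ξ i * K⌋₊ : ℝ) / K) x| =
      |linForm (fun i => (η' i : ℝ)) x| / K := by
    intro x
    rw [← abs_of_pos hK0, ← abs_div, abs_of_pos hK0, linForm, linForm, Finset.sum_div]
    congr 1
    exact Finset.sum_congr rfl fun i _ => by simp [η']; ring
  obtain ⟨v, hv, hv0, hvη, hvη'⟩ := exists_relation_ker_ker hm hB η η'
  refine ⟨η', max b (height v), (hK.congr (fun _ _ => Iff.rfl) fun x y h => ?_).mono_right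
    (le_max_left _ _), v, hv, hvη, hvη', height_pos_iff.2 hv0, le_max_right _ _⟩
  rw [hscale, hscale] at h
  exact (div_lt_div_iff_of_pos_right hK0).1 h

end Lattice

/-! ### The sequence of best approximations -/

section Sequence

variable {m : ℕ} {Θ : Fin m → ℝ}

lemma Improves.exists_isBestApprox {a b : ℕ} (h : Improves (zeta Θ) Set.univ a b) :
    ∃ x, IsBestApprox Θ x ∧ a < height x ∧ height x ≤ b := by
  obtain ⟨y, -, hy0, hyb, hy⟩ := h
  obtain ⟨x, ⟨hxb, hx0⟩, hmin⟩ := Set.exists_min_image {x : Fin m → ℤ | height x ≤ b ∧ 0 < height x}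
    (zeta Θ) ((finite_height_le b).subset fun x hx => hx.1) ⟨y, hyb, hy0⟩
  refine ⟨x, ⟨hx0, fun x' h0 hle => hmin x' ⟨hle.trans hxb, h0⟩⟩, ?_, hxb⟩
  by_contra! hxa
  exact (hmin y ⟨hyb, hy0⟩).not_gt (hy x trivial hx0 hxa)

/-- If the minimum of `ζ_Θ` drops beyond every height, there is no relation: it could not drop
below the value zero. -/
lemma relations_trivial (h : ∀ a, ∃ c b, a ≤ c ∧ Improves (zeta Θ) Set.univ c b) :
    ∀ x ∈ relations Θ, x = 0 := by
  intro x hx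
  by_contra hx0
  obtain ⟨c, b, hc, y, -, -, -, hy⟩ := h (height x)
  have := hy x trivial (height_pos_iff.2 hx0) hc
  rw [zeta_eq_zero_iff.2 hx] at this
  exact this.not_ge (zeta_nonneg _ _)

lemma exists_isBestApproxSeq (h : ∀ a, ∃ c b, a ≤ c ∧ Improves (zeta Θ) Set.univ c b) :
    ∃ x : ℕ+ → Fin m → ℤ, IsBestApproxSeq Θ x := by
  have hrel := relations_trivial h
  let p : ℕ → Prop := fun k => ∃ x, IsBestApprox Θ x ∧ height x = k
  have hinf : (Set.ofPred p).Infinite := by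
    refine Set.infinite_of_not_bddAbove ?_
    rintro ⟨a, ha⟩
    obtain ⟨c, b, hc, himp⟩ := h a
    obtain ⟨x, hx, hcx, -⟩ := himp.exists_isBestApprox
    have : height x ≤ a := ha ⟨x, hx, rfl⟩
    omega
  choose x hx hxh using Nat.nth_mem_of_infinite hinf
  have hmono : StrictMono fun ν : ℕ+ => height (x ν.natPred) := by
    intro ν μ hlt
    simp only [hxh]
    exact Nat.nth_strictMono hinf (PNat.natPred_lt_natPred.2 hlt)
  refine ⟨fun ν => x ν.natPred, fun v => ⟨fun hv => ?_, ?_⟩, hmono, fun ν μ hlt => ?_⟩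
  · have hmem : height v ∈ Set.range (Nat.nth p) := by
      rw [Nat.range_nth_of_infinite hinf]
      exact ⟨v, hv, rfl⟩
    obtain ⟨n, hn⟩ := hmem
    have hheight : height (x n) = height v := (hxh n).trans hn
    refine ⟨n.succPNat, ?_⟩
    rw [Nat.natPred_succPNat]
    exact eq_or_eq_neg_of_zeta_eq hrel
      (le_antisymm (hv.2 _ (hx n).1 hheight.le) ((hx n).2 _ hv.1 hheight.ge))
  · rintro ⟨ν, rfl | rfl⟩
    · exact hx _
    · refine ⟨by rw [height_neg]; exact (hx _).1, fun x' h0 hle => ?_⟩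
      rw [zeta_neg]
      exact (hx _).2 x' h0 (by rwa [height_neg] at hle)
  · have hht : height (x ν.natPred) < height (x μ.natPred) := hmono hlt
    refine lt_of_le_of_ne ((hx _).2 _ (hx _).1 hht.le) fun heq => ?_
    rcases eq_or_eq_neg_of_zeta_eq hrel heq with h | h
    · exact hht.ne' (by rw [h])
    · exact hht.ne' (by rw [h, height_neg])

variable {x : ℕ+ → Fin m → ℤ}

lemma IsBestApproxSeq.isBestApprox (hx : IsBestApproxSeq Θ x) (ν : ℕ+) : IsBestApprox Θ (x ν) :=
  (hx.isBestApprox_iff _).2 ⟨ν, .inl rfl⟩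

lemma IsBestApproxSeq.le_height (hx : IsBestApproxSeq Θ x) (ν : ℕ+) : (ν : ℕ) ≤ height (x ν) := by
  induction ν using PNat.recOn with
  | one => exact (hx.isBestApprox 1).1
  | succ ν ih =>
    have : height (x ν) < height (x (ν + 1)) := hx.height_strictMono (PNat.lt_add_right ν 1)
    rw [PNat.add_coe, PNat.one_coe]
    omega

lemma IsBestApproxSeq.exists_of_improves (hx : IsBestApproxSeq Θ x) {a b : ℕ}
    (h : Improves (zeta Θ) Set.univ a b) : ∃ ν, a < height (x ν) ∧ height (x ν) ≤ b := by
  obtain ⟨v, hv, ha, hb⟩ := h.exists_isBestApprox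
  obtain ⟨ν, rfl | rfl⟩ := (hx.isBestApprox_iff v).1 hv
  · exact ⟨ν, ha, hb⟩
  · rw [height_neg] at ha hb
    exact ⟨ν, ha, hb⟩

/-- If the minimum of `ζ_Θ` drops `n` times up to the height `b`, then the `n`-th best approximation
has height at most `b`. -/
lemma IsBestApproxSeq.height_le_of_chain (hx : IsBestApproxSeq Θ x) (n : ℕ+) {a b : ℕ}
    (h : Chain (zeta Θ) Set.univ n a b) : height (x n) ≤ b := by
  induction n using PNat.recOn generalizing b with
  | one =>
    obtain ⟨c, -, hcb⟩ := h
    obtain ⟨ν, -, hν⟩ := hx.exists_of_improves hcb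
    exact (hx.height_strictMono.monotone one_le).trans hν
  | succ n ih =>
    obtain ⟨c, hc, hcb⟩ := h
    obtain ⟨ν, hcν, hν⟩ := hx.exists_of_improves hcb
    have hlt : n < ν := hx.height_strictMono.lt_iff_lt.1 ((ih hc).trans_lt hcν)
    exact (hx.height_strictMono.monotone (PNat.add_one_le_iff.2 hlt)).trans hν

end Sequence

/-! ### The inductive construction -/

section Construction

variable {m : ℕ}

/-- A stage of the construction: a rational vector, the integral direction of the next perturbation,
the heights between which the current drops occur, and the radius of the ball to which later stages
are confined. `N` prescribes the number of drops in terms of the lower height. -/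
structure Stage (m : ℕ) (N : ℕ → ℕ+) where
  /-- the base point -/
  base : Fin m → ℝ
  /-- the direction of the next perturbation -/
  dir : Fin m → ℤ
  /-- the lower height -/
  lower : ℕ
  /-- the upper height -/
  upper : ℕ
  /-- the radius of the confining ball -/
  radius : ℝ
  radius_pos : 0 < radius
  rational : IsRationalVec base
  chain : Chain (fun x => |linForm (fun i => (dir i : ℝ)) x|) (relations base) (N lower) lower upper
  exists_lower : ∃ u ∈ relations base, 0 < height u ∧ height u ≤ lower
  exists_upper : ∃ v ∈ relations base, intForm dir v = 0 ∧ 0 < height v ∧ height v ≤ upper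

/-- The ball to which the stages after `s` are confined. -/
def Stage.ball {N : ℕ → ℕ+} (s : Stage m N) : Set (Fin m → ℝ) :=
  Metric.closedBall s.base s.radius

lemma exists_initial_stage (hm : 3 ≤ m) (N : ℕ → ℕ+) : ∃ s : Stage m N, s.lower = 1 := by
  have hrat : IsRationalVec (0 : Fin m → ℝ) := ⟨1, one_ne_zero, fun i => ⟨0, by simp⟩⟩
  have hrel : ∀ x, x ∈ relations (0 : Fin m → ℝ) := fun x => ⟨0, by simp [linForm]⟩
  obtain ⟨η, b, hchain, v, hv, -, hvη, hv0, hvb⟩ := exists_intDirection hm hrat 0 (N 1) 1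
  refine ⟨⟨0, η, 1, b, 1, one_pos, hrat, hchain.congr (fun x _ => ?_) fun _ _ h => h, ?_,
    v, hv, hvη, hv0, hvb⟩, rfl⟩
  · simp [hrel, intForm]
  · refine ⟨fun _ => 1, hrel _, height_pos_iff.2 fun h => ?_, ?_⟩
    · exact one_ne_zero (congrFun h ⟨0, by omega⟩)
    · exact Finset.sup_le fun i _ => by simp

lemma IsRationalVec.add_smul {B : Fin m → ℝ} (hB : IsRationalVec B) (η : Fin m → ℤ) (K : ℕ) :
    IsRationalVec (B + (1 / ((K : ℝ) + 1)) • fun i => (η i : ℝ)) := by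
  obtain ⟨d, hd, h⟩ := hB
  refine ⟨d * (K + 1), mul_ne_zero hd (by positivity), fun i => ?_⟩
  obtain ⟨n, hn⟩ := h i
  refine ⟨(K + 1) * n + d * η i, ?_⟩
  have : (K : ℝ) + 1 ≠ 0 := by positivity
  simp only [Pi.add_apply, Pi.smul_apply, smul_eq_mul]
  push_cast
  rw [← hn]
  field_simp

/-- From each stage there is a next one, whose ball forces the drops of the present stage and a value
of `ζ` below `ψ` at the height that the next stage reaches. -/
lemma Stage.exists_next (hm : 3 ≤ m) {ψ : ℝ → ℝ} (hψ : ∀ t : ℝ, 1 ≤ t → 0 < ψ t)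
    {N : ℕ → ℕ+} (s : Stage m N) :
    ∃ t : Stage m N, t.lower = s.upper ∧ t.ball ⊆ s.ball ∧ ∀ Θ ∈ t.ball,
      Chain (zeta Θ) Set.univ (N s.lower) s.lower s.upper ∧
      ∃ u, 0 < height u ∧ height u ≤ s.lower ∧ zeta Θ u < ψ t.upper := by
  obtain ⟨η, H, hchain, w, hw, hws, hwη, hw0, hwH⟩ :=
    exists_intDirection hm s.rational s.dir (N s.upper) s.upper
  obtain ⟨u, hu, hu0, hul⟩ := s.exists_lower
  obtain ⟨v, hv, hvs, hv0, hvl⟩ := s.exists_upper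
  have hψH : 0 < ψ H := hψ _ (by exact_mod_cast hw0.trans_le hwH)
  set e : Fin m → ℝ := fun i => (s.dir i : ℝ) with he
  have hker : ∀ x, linForm e x = 0 ↔ intForm s.dir x = 0 := fun x => by
    rw [he, linForm_intCast, Int.cast_eq_zero]
  have hu_small : ∀ᶠ δ in 𝓝[>] (0 : ℝ), zeta (s.base + δ • e) u < ψ H :=
    (tendsto_zeta_perturb s.base e u).eventually_lt_const (by rwa [zeta_eq_zero_iff.2 hu])
  have hball : ∀ᶠ δ in 𝓝[>] (0 : ℝ), s.base + δ • e ∈ Metric.ball s.base s.radius :=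
    (tendsto_perturb s.base e).eventually (Metric.ball_mem_nhds _ s.radius_pos)
  -- The reciprocals of integers keep the perturbed vector rational.
  have hlim : Tendsto (fun K : ℕ => 1 / ((K : ℝ) + 1)) atTop (𝓝[>] 0) :=
    tendsto_nhdsWithin_iff.2 ⟨tendsto_one_div_add_atTop_nhds_zero_nat,
      .of_forall fun K => by simp only [Set.mem_Ioi]; positivity⟩
  obtain ⟨K, hK_chain, hK_rel, hK_u, hK_ball⟩ := (hlim.eventually (s.chain.eventually_perturb.and
    ((eventually_mem_relations_iff s.base e H).and (hu_small.and hball)))).exists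
  set B : Fin m → ℝ := s.base + (1 / ((K : ℝ) + 1)) • e with hB
  have hrel : ∀ x, height x ≤ H →
      (x ∈ relations B ↔ x ∈ {x | x ∈ relations s.base ∧ intForm s.dir x = 0}) := fun x hx => by
    rw [hK_rel x hx, hker]
    rfl
  have hopen : ∀ᶠ Θ in 𝓝 B, Θ ∈ Metric.ball s.base s.radius ∧
      Chain (zeta Θ) Set.univ (N s.lower) s.lower s.upper ∧ zeta Θ u < ψ H :=
    (show ∀ᶠ Θ in 𝓝 B, Θ ∈ Metric.ball s.base s.radius from
      Metric.isOpen_ball.mem_nhds hK_ball).and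
      ((hK_chain.eventually fun x => (continuous_zeta x).tendsto B).and
        (((continuous_zeta u).tendsto B).eventually_lt_const hK_u))
  obtain ⟨r, hr, hrsub⟩ := Metric.nhds_basis_closedBall.eventually_iff.1 hopen
  have hsH : s.upper ≤ H := hchain.le
  refine ⟨⟨B, η, s.upper, H, r, hr, s.rational.add_smul s.dir K,
    hchain.congr hrel fun _ _ h => h, ⟨v, (hrel v (hvl.trans hsH)).2 ⟨hv, hvs⟩, hv0, hvl⟩,
    ⟨w, (hrel w hwH).2 ⟨hw, hws⟩, hwη, hw0, hwH⟩⟩, rfl, fun Θ hΘ => ?_, fun Θ hΘ => ?_⟩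
  · exact Metric.ball_subset_closedBall (hrsub hΘ).1
  · exact ⟨(hrsub hΘ).2.1, u, hu0, hul, (hrsub hΘ).2.2⟩

/-- The limit vector of the construction, with the heights `H k` of its stages. -/
lemma exists_limit (hm : 3 ≤ m) {ψ : ℝ → ℝ} (hψ : ∀ t : ℝ, 1 ≤ t → 0 < ψ t) (N : ℕ → ℕ+) :
    ∃ (Θ : Fin m → ℝ) (H : ℕ → ℕ), H 0 = 1 ∧ ∀ k,
      Chain (zeta Θ) Set.univ (N (H k)) (H k) (H (k + 1)) ∧
      ∃ u, 0 < height u ∧ height u ≤ H k ∧ zeta Θ u < ψ (H (k + 2)) := by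
  obtain ⟨s₀, hs₀⟩ := exists_initial_stage hm N
  choose next hlower hsub hnext using fun s : Stage m N => s.exists_next hm hψ
  let s : ℕ → Stage m N := fun k => next^[k] s₀
  have hs : ∀ k, s (k + 1) = next (s k) := fun k => Function.iterate_succ_apply' next k s₀
  obtain ⟨Θ, hΘ⟩ := IsCompact.nonempty_iInter_of_sequence_nonempty_isCompact_isClosed
    (fun k => (s k).ball) (fun k => by rw [hs]; exact hsub _)
    (fun k => ⟨(s k).base, Metric.mem_closedBall_self (s k).radius_pos.le⟩)
    (isCompact_closedBall _ _) fun k => Metric.isClosed_closedBall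
  rw [Set.mem_iInter] at hΘ
  have hupper : ∀ k, (s k).upper = (s (k + 1)).lower := fun k => by rw [hs, hlower]
  refine ⟨Θ, fun k => (s k).lower, hs₀, fun k => ?_⟩
  have := hnext (s k) Θ (by rw [← hs]; exact hΘ (k + 1))
  rwa [← hs, hupper, hupper] at this

end Construction

end BestApprox

open BestApprox in
theorem mainTheorem12 (m : ℕ) (hm : 3 ≤ m)
    (ψ : ℝ → ℝ) (hψ_pos : ∀ t : ℝ, 1 ≤ t → 0 < ψ t)
    (hψ_anti : AntitoneOn ψ (Set.Ici 1)) (hψ_lim : Tendsto ψ atTop (𝓝 0))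
    (τ : ℕ+ → ℕ+) (hτ : Tendsto τ atTop atTop) :
    ∃ Θ : Fin m → ℝ, BestApprox.dimZ Θ = m + 1 ∧
      (∃ x : ℕ+ → Fin m → ℤ, BestApprox.IsBestApproxSeq Θ x) ∧
      ∀ x : ℕ+ → Fin m → ℤ, BestApprox.IsBestApproxSeq Θ x →
        ∀ ν : ℕ+, BestApprox.zeta Θ (x ν) ≤ ψ (BestApprox.height (x (ν + τ ν)) : ℝ) := by
  have hN : ∀ h : ℕ, ∃ n : ℕ+, ∀ ν : ℕ+, (ν : ℕ) ≤ h → ν + τ ν ≤ n := by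
    intro h
    induction h with
    | zero => exact ⟨1, fun ν hν => absurd ν.pos hν.not_gt⟩
    | succ h ih =>
      obtain ⟨n, hn⟩ := ih
      refine ⟨n + (h.succPNat + τ h.succPNat), fun ν hν => ?_⟩
      rcases Nat.le_or_eq_of_le_succ hν with hle | heq
      · exact (hn ν hle).trans (PNat.lt_add_right _ _).le
      · obtain rfl : ν = h.succPNat := PNat.eq heq
        exact (PNat.lt_add_left _ _).le
  choose N hN using hN
  obtain ⟨Θ, H, hH0, hH⟩ := exists_limit hm hψ_pos N
  have hmono : StrictMono H := strictMono_nat_of_lt_succ fun k => (hH k).1.lt (N (H k)).pos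
  have himp : ∀ a, ∃ c b, a ≤ c ∧ Improves (zeta Θ) Set.univ c b := fun a => by
    obtain ⟨c, hc, hcb⟩ := (hH a).1.exists_improves (N (H a)).pos
    exact ⟨c, _, hmono.le_apply.trans hc, hcb⟩
  refine ⟨Θ, dimZ_eq_of_relations (relations_trivial himp), exists_isBestApproxSeq himp,
    fun x hx ν => ?_⟩
  obtain ⟨k, hk, hk'⟩ : ∃ k, H k ≤ height (x ν) ∧ height (x ν) ≤ H (k + 1) := by
    have hex : ∃ k, height (x ν) ≤ H (k + 1) := ⟨height (x ν), (Nat.le_succ _).trans hmono.le_apply⟩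
    classical
    refine ⟨Nat.find hex, ?_, Nat.find_spec hex⟩
    cases hf : Nat.find hex with
    | zero =>
      rw [hH0]
      exact (hx.isBestApprox ν).1
    | succ j =>
      have := Nat.find_min hex (show j < Nat.find hex by omega)
      omega
  obtain ⟨u, hu0, hu, huψ⟩ := (hH k).2
  have hle : height (x (ν + τ ν)) ≤ H (k + 2) :=
    (hx.height_strictMono.monotone (hN _ ν ((hx.le_height ν).trans hk'))).trans
      (hx.height_le_of_chain _ (hH (k + 1)).1)
  have hone : 1 ≤ height (x (ν + τ ν)) := (hx.isBestApprox _).1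
  calc zeta Θ (x ν) ≤ zeta Θ u := (hx.isBestApprox ν).2 u hu0 (hu.trans hk)
    _ ≤ ψ (H (k + 2)) := huψ.le
    _ ≤ ψ (height (x (ν + τ ν))) := hψ_anti (by simpa using hone)
        (by simpa using hone.trans hle) (by exact_mod_cast hle)
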